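/- Let $R$ be a semi-local Noetherian integral domain all of whose residue fields at maximal ideals are infinite and of characteristic different from $2$ (so that $2\in R^*$). Let $S$ be a finite étale $R$-algebra (not necessarily a domain) of degree $n=\operatorname{rank}_R S$, and let $N^S_R:S^*\to R^*$ be the norm map. Let $(V,q)$ be a quadratic space over $R$, i.e. a finitely generated projective $R$-module $V$ with a quadratic form $q:V\to R$ whose polar form $b_q(v,w)=q(v+w)-q(v)-q(w)$ induces a bijection $V\to\operatorname{Hom}_R(V,R)$, and let $(V_S,q_S)$ be its base change to $S$. For an integer $i\ge 0$ let $D^i_q(S)\subset S^*$ be the set of all products $q_S(v_1)\cdots q_S(v_l)$ with $l\ge 0$, $l\equiv i \pmod 2$, $v_j\in V_S$ and $q_S(v_j)\in S^*$ (the empty product being $1$); define $D^i_q(R)\subset R^*$ in the same way from $q$. Thus $D^i_q$ depends only on the parity of $i$, and $D^0_q$ is a group. Then $$N^S_R\bigl(D^0_q(S)\bigr)\subset D^0_q(R).$$ More precisely, for every unit $a\in S^*$ that is represented by $q_S$, i.e. $a=q_S(v)$ for some $v\in V_S$, one has $$N^S_R(a)\in D^n_q(R).$$ -/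

import Mathlib

open scoped TensorProduct

namespace NormPrinciple

/-- A quadratic form `q` is unimodular if the adjoint map `V → Hom(V, R)`, `v ↦ b_q(v, ·)`, of its
polar bilinear form `b_q(v, w) = q(v + w) - q(v) - q(w)` is bijective. -/
def IsUnimodular {R V : Type*} [CommRing R] [AddCommGroup V] [Module R V]
    (q : QuadraticForm R V) : Prop :=
  Function.Bijective (fun v : V => (QuadraticMap.polarBilin q v : Module.Dual R V))

/-- A quadratic space over `R`: a finitely generated projective module with a unimodular
quadratic form. -/
structure IsQuadraticSpace {R V : Type*} [CommRing R] [AddCommGroup V] [Module R V]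
    (q : QuadraticForm R V) : Prop where
  finite : Module.Finite R V
  projective : Module.Projective R V
  unimodular : IsUnimodular q

/-- If every residue field at a maximal ideal has characteristic different from `2`,
then `2` is a unit. -/
theorem isUnit_two_of_residue {R : Type*} [CommRing R]
    (h : ∀ m : Ideal R, m.IsMaximal → ringChar (R ⧸ m) ≠ 2) : IsUnit (2 : R) := by
  by_contra h2
  obtain ⟨m, hm, h2m⟩ := exists_max_ideal_of_mem_nonunits h2
  have : Nontrivial (R ⧸ m) := Ideal.Quotient.nontrivial_iff.mpr hm.ne_top
  have h0 : ((2 : ℕ) : R ⧸ m) = 0 := by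
    rw [← map_natCast (Ideal.Quotient.mk m) 2]
    exact Ideal.Quotient.eq_zero_iff_mem.mpr (by exact_mod_cast h2m)
  have hd : ringChar (R ⧸ m) ∣ 2 := ringChar.dvd h0
  rcases (Nat.dvd_prime Nat.prime_two).mp hd with h1 | h1
  · exact CharP.ringChar_ne_one h1
  · exact h m hm h1

/-- The inverse of `2`, under the same hypothesis on the residue fields. -/
noncomputable abbrev invertibleTwo {R : Type*} [CommRing R]
    (h : ∀ m : Ideal R, m.IsMaximal → ringChar (R ⧸ m) ≠ 2) : Invertible (2 : R) :=
  (isUnit_two_of_residue h).invertible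

section Products

variable {A M : Type*} [CommRing A] [AddCommGroup M] [Module A M]

/-- The unit `a` is a value of the quadratic form `Q`. -/
def Represents (Q : QuadraticForm A M) (a : Aˣ) : Prop :=
  ∃ v : M, Q v = (a : A)

/-- `D^n_Q(A)`: the set of all products `Q(v₁) ⋯ Q(v_l)` of units represented by `Q` whose number
of factors `l` has the same parity as `n` (the empty product, `l = 0`, counts as even). -/
def parityProducts (Q : QuadraticForm A M) (n : ℕ) : Set Aˣ :=
  {a | ∃ l : List Aˣ, (∀ x ∈ l, Represents Q x) ∧ l.length ≡ n [MOD 2] ∧ l.prod = a}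

theorem Represents.inv {Q : QuadraticForm A M} {a : Aˣ} (h : Represents Q a) :
    Represents Q a⁻¹ := by
  obtain ⟨v, hv⟩ := h
  refine ⟨((a⁻¹ : Aˣ) : A) • v, ?_⟩
  rw [QuadraticMap.map_smul, hv, smul_eq_mul, mul_assoc, Units.inv_mul, mul_one]

/-- `D^0_Q(A)`: the group of even products of units represented by `Q`. -/
def evenProducts (Q : QuadraticForm A M) : Subgroup Aˣ where
  carrier := parityProducts Q 0
  one_mem' := ⟨[], by simp, rfl, rfl⟩
  mul_mem' := by
    rintro a b ⟨l, hl, hn, rfl⟩ ⟨l', hl', hn', rfl⟩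
    refine ⟨l ++ l', ?_, ?_, List.prod_append⟩
    · intro x hx
      rcases List.mem_append.mp hx with h | h
      exacts [hl x h, hl' x h]
    · rw [List.length_append]
      exact hn.add hn'
  inv_mem' := by
    rintro a ⟨l, hl, hn, rfl⟩
    refine ⟨l.map (fun x => x⁻¹), ?_, ?_, ?_⟩
    · intro x hx
      obtain ⟨y, hy, rfl⟩ := List.mem_map.mp hx
      exact (hl y hy).inv
    · rwa [List.length_map]
    · exact (List.prod_inv l).symm

end Products

/-- The norm map `N^S_R : Sˣ → Rˣ` on units. -/
noncomputable def unitNorm (R S : Type*) [CommRing R] [CommRing S] [Algebra R S] : Sˣ →* Rˣ :=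
  Units.map (Algebra.norm R)

end NormPrinciple

open Polynomial

namespace NormPrinciple

/-- The quadratic form `x ↦ ∑ xᵢ Bᵢⱼ xⱼ` given by a square matrix `B`. -/
noncomputable def gramForm {A ι : Type*} [CommRing A] [Fintype ι] (B : Matrix ι ι A) :
    QuadraticForm A (ι → A) :=
  letI := Classical.decEq ι
  B.toQuadraticForm'

section GramForm

variable {A A' ι : Type*} [CommRing A] [CommRing A'] [Fintype ι]

theorem gramForm_apply (B : Matrix ι ι A) (x : ι → A) :
    gramForm B x = ∑ i, ∑ j, x i * B i j * x j := by
  classical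
  simp only [gramForm, Matrix.toQuadraticForm', LinearMap.BilinMap.toQuadraticMap_apply,
    Matrix.toLinearMap₂'_apply, smul_eq_mul]
  refine Finset.sum_congr rfl fun i _ => Finset.sum_congr rfl fun j _ => ?_
  ring

theorem map_gramForm (φ : A →+* A') (B : Matrix ι ι A) (x : ι → A) :
    φ (gramForm B x) = gramForm (B.map φ) (fun i => φ (x i)) := by
  simp [gramForm_apply]

theorem map_polar_gramForm (φ : A →+* A') (B : Matrix ι ι A) (x y : ι → A) :
    φ (QuadraticMap.polar (gramForm B) x y) =
      QuadraticMap.polar (gramForm (B.map φ)) (fun i => φ (x i)) (fun i => φ (y i)) := by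
  simp only [QuadraticMap.polar, map_sub, map_gramForm, Pi.add_apply, map_add]
  rfl

/-- The form of `B` over the polynomial ring. -/
noncomputable abbrev polyForm (B : Matrix ι ι A) : QuadraticForm A[X] (ι → A[X]) :=
  gramForm (B.map C)

theorem eval_polyForm (B : Matrix ι ι A) (x : ι → A[X]) (c : A) :
    (polyForm B x).eval c = gramForm B (fun i => (x i).eval c) := by
  have h := map_gramForm (evalRingHom c) (B.map C) x
  rw [Matrix.map_map] at h
  have e : B.map (evalRingHom c ∘ C) = B := by ext; simp
  rw [e] at h
  exact h

theorem map_polyForm (φ : A →+* A') (B : Matrix ι ι A) (x : ι → A[X]) :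
    (polyForm B x).map φ = polyForm (B.map φ) (fun i => (x i).map φ) := by
  have h := map_gramForm (mapRingHom φ) (B.map C) x
  have e : (B.map C).map (mapRingHom φ) = (B.map φ).map C := by ext; simp
  rw [e] at h
  exact h

theorem map_polar_polyForm (φ : A →+* A') (B : Matrix ι ι A) (x y : ι → A[X]) :
    (QuadraticMap.polar (polyForm B) x y).map φ =
      QuadraticMap.polar (polyForm (B.map φ)) (fun i => (x i).map φ) (fun i => (y i).map φ) := by
  have h := map_polar_gramForm (mapRingHom φ) (B.map C) x y
  have e : (B.map C).map (mapRingHom φ) = (B.map φ).map C := by ext; simp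
  rw [e] at h
  exact h

theorem dvd_gramForm_sub {B : Matrix ι ι A} {p : A} {x y : ι → A} (h : ∀ i, p ∣ x i - y i) :
    p ∣ gramForm B x - gramForm B y := by
  simp only [← Ideal.mem_span_singleton, ← Ideal.Quotient.eq] at h ⊢
  rw [map_gramForm, map_gramForm]
  simp only [h]

theorem natDegree_polyForm_le {B : Matrix ι ι A} {x : ι → A[X]} {d : ℕ}
    (h : ∀ i, (x i).natDegree ≤ d) : (polyForm B x).natDegree ≤ d + d := by
  rw [gramForm_apply]
  refine natDegree_sum_le_of_forall_le _ _ fun i _ => natDegree_sum_le_of_forall_le _ _ fun j _ => ?_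
  refine natDegree_mul_le_of_le ?_ (h j)
  refine (natDegree_mul_le_of_le (h i) (n := 0) ?_).trans (by simp)
  simp

theorem polar_add_smul_add_smul {M : Type*} [AddCommGroup M] [Module A M] (Q : QuadraticForm A M)
    (e y : M) (a b a' b' : A) (he : Q e = 0) (hy : Q y = 0) :
    QuadraticMap.polar Q (a • e + b • y) (a' • e + b' • y) =
      (a * b' + b * a') * QuadraticMap.polar Q e y := by
  have h1 : QuadraticMap.polar Q e e = 0 := by rw [QuadraticMap.polar_self, he, smul_zero]
  have h2 : QuadraticMap.polar Q y y = 0 := by rw [QuadraticMap.polar_self, hy, smul_zero]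
  simp only [QuadraticMap.polar_add_left, QuadraticMap.polar_add_right,
    QuadraticMap.polar_smul_left, QuadraticMap.polar_smul_right, h1, h2,
    QuadraticMap.polar_comm Q y e, smul_eq_mul]
  ring

theorem map_smul_add_smul {M : Type*} [AddCommGroup M] [Module A M] (Q : QuadraticForm A M)
    (e y : M) (a b : A) (he : Q e = 0) (hy : Q y = 0) :
    Q (a • e + b • y) = a * b * QuadraticMap.polar Q e y := by
  rw [QuadraticMap.map_add Q, QuadraticMap.map_smul, QuadraticMap.map_smul, he, hy,
    QuadraticMap.polar_smul_left, QuadraticMap.polar_smul_right]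
  simp only [smul_eq_mul]
  ring

/-- The value of `Q` at `v - s b(x, v) x`, the reflection of `v` along `x` if `s Q(x) = 1`. -/
theorem map_sub_smul_polar {M : Type*} [AddCommGroup M] [Module A M] (Q : QuadraticForm A M)
    (x v : M) (s : A) :
    Q (v - (s * QuadraticMap.polar Q x v) • x) =
      Q v + s * QuadraticMap.polar Q x v ^ 2 * (s * Q x - 1) := by
  rw [sub_eq_add_neg, ← neg_smul, QuadraticMap.map_add Q, QuadraticMap.map_smul,
    QuadraticMap.polar_smul_right, QuadraticMap.polar_comm Q v x]
  simp only [smul_eq_mul]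
  ring

end GramForm

section GenericProducts

variable {k : Type*} [Field k]

/-- The form `g ↦ Q ((X - β) g)`. -/
noncomputable def mulForm (Q : QuadraticForm k k[X]) (β : k) : QuadraticForm k k[X] :=
  Q.comp (LinearMap.mulLeft k (X - C β))

theorem mulForm_apply (Q : QuadraticForm k k[X]) (β : k) (g : k[X]) :
    mulForm Q β g = Q ((X - C β) * g) := rfl

/-- `Q` does not vanish identically on polynomials of degree at most `d`. -/
def NonzeroUpTo (Q : QuadraticForm k k[X]) (d : ℕ) : Prop :=
  ∃ g : k[X], g.natDegree ≤ d ∧ Q g ≠ 0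

theorem finite_not_nonzeroUpTo_mulForm {Q : QuadraticForm k k[X]} {d : ℕ}
    (hQ : NonzeroUpTo Q (d + 1)) : {β : k | ¬ NonzeroUpTo (mulForm Q β) d}.Finite := by
  by_contra hinf
  have key : ∀ g : k[X], g.natDegree ≤ d →
      Q (X * g) = 0 ∧ QuadraticMap.polar Q (X * g) g = 0 ∧ Q g = 0 := by
    intro g hg
    have hz : C (Q (X * g)) - C (QuadraticMap.polar Q (X * g) g) * X + C (Q g) * X ^ 2 = 0 := by
      refine eq_zero_of_infinite_isRoot _ (Set.Infinite.mono ?_ hinf)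
      intro β hβ
      simp only [NonzeroUpTo, Set.mem_ofPred_eq, not_exists, not_and, not_not] at hβ
      have h := hβ g hg
      rw [mulForm_apply] at h
      have e : (X - C β) * g = X * g + (-β) • g := by
        rw [smul_eq_C_mul, C_neg]; ring
      rw [e, QuadraticMap.map_add Q, QuadraticMap.map_smul, QuadraticMap.polar_smul_right] at h
      simp only [smul_eq_mul] at h
      simp only [Set.mem_ofPred_eq, IsRoot, eval_add, eval_sub, eval_mul, eval_C, eval_X, eval_pow]
      linear_combination h
    have h0 := congrArg (fun r => coeff r 0) hz
    have h1 := congrArg (fun r => coeff r 1) hz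
    have h2 := congrArg (fun r => coeff r 2) hz
    simp [coeff_X, coeff_C, coeff_X_pow] at h0 h1 h2
    exact ⟨h0, h1, h2⟩
  have hpol : ∀ g g' : k[X], g.natDegree ≤ d → g'.natDegree ≤ d →
      QuadraticMap.polar Q (X * g) (X * g') = 0 ∧
      QuadraticMap.polar Q (X * g) g' = - QuadraticMap.polar Q (X * g') g := by
    intro g g' hg hg'
    have ha : (g + g').natDegree ≤ d := natDegree_add_le_of_degree_le hg hg'
    obtain ⟨a1, a2, a3⟩ := key _ ha
    obtain ⟨b1, b2, b3⟩ := key _ hg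
    obtain ⟨c1, c2, c3⟩ := key _ hg'
    rw [mul_add] at a1 a2
    rw [QuadraticMap.map_add Q, b1, c1] at a1
    simp only [QuadraticMap.polar_add_left, QuadraticMap.polar_add_right, b2, c2] at a2
    exact ⟨by simpa using a1, by linear_combination a2⟩
  obtain ⟨g, hg, hne⟩ := hQ
  apply hne
  have hd1 : ∀ r : k[X], ∀ m, r.natDegree ≤ m + 1 → r.divX.natDegree ≤ m := by
    intro r m hr; rw [natDegree_divX_eq_natDegree_tsub_one]; omega
  have hd0 : ∀ r : k[X], r.natDegree ≤ d → r.divX.natDegree ≤ d := by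
    intro r hr; rw [natDegree_divX_eq_natDegree_tsub_one]; omega
  have hg1 := hd1 g d hg
  have hC : ∀ c : k, (C c).natDegree ≤ d := by intro c; simp
  have h1 : QuadraticMap.polar Q (X * g.divX) (C (g.coeff 0)) = 0 := by
    rw [(hpol _ _ hg1 (hC _)).2, neg_eq_zero]
    conv_lhs => rw [← X_mul_divX_add g.divX]
    rw [QuadraticMap.polar_add_right, (hpol _ _ (hC _) (hd0 _ hg1)).1, zero_add,
      ← mul_one (C (g.coeff 0)), ← mul_one (C (g.divX.coeff 0)), ← smul_eq_C_mul,
      ← smul_eq_C_mul, mul_smul_comm, QuadraticMap.polar_smul_left, QuadraticMap.polar_smul_right,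
      (key 1 (by simp)).2.1, smul_zero, smul_zero]
  conv_lhs => rw [← X_mul_divX_add g]
  rw [QuadraticMap.map_add Q, h1, (key _ hg1).1, (key _ (hC _)).2.2]
  simp

/-- Given nonzero quadratic forms on polynomials, there is a product `P` of `d` linear factors
on which the forms of `F` do not vanish, and such that `Q'` vanishes on no `P / (X - β)`. -/
theorem exists_split_monic [Infinite k] (E : Set k) (hE : E.Finite) (d : ℕ) :
    ∀ (F : List (QuadraticForm k k[X])) (Q' : QuadraticForm k k[X]),
      (∀ Q ∈ F, NonzeroUpTo Q d) → (1 ≤ d → NonzeroUpTo Q' (d - 1)) →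
      ∃ P : k[X], P.Monic ∧ P.natDegree = d ∧ (∀ Q ∈ F, Q P ≠ 0) ∧
        (∀ h : k[X], (∀ β, P.IsRoot β → h.eval β ≠ 0) → IsCoprime P h) ∧
        ∀ β, P.IsRoot β → β ∉ E ∧ ∃ P', P = (X - C β) * P' ∧ Q' P' ≠ 0 := by
  induction d with
  | zero =>
    intro F Q' hF _
    refine ⟨1, monic_one, natDegree_one, ?_, fun h _ => isCoprime_one_left, ?_⟩
    · intro Q hQ h1
      obtain ⟨g, hg, hne⟩ := hF Q hQ
      rw [eq_C_of_natDegree_le_zero hg, ← mul_one (C _), ← smul_eq_C_mul, QuadraticMap.map_smul,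
        h1, smul_zero] at hne
      exact hne rfl
    · intro β hβ; simp at hβ
  | succ d ih =>
    intro F Q' hF hQ'
    have hQ'd : NonzeroUpTo Q' d := hQ' (by omega)
    have hfin : (E ∪ (⋃ Q ∈ {Q | Q ∈ F}, {β : k | ¬ NonzeroUpTo (mulForm Q β) d}) ∪
        {β : k | 1 ≤ d ∧ ¬ NonzeroUpTo (mulForm Q' β) (d - 1)}).Finite := by
      refine (hE.union (Set.Finite.biUnion (List.finite_toSet F) fun Q hQ =>
        finite_not_nonzeroUpTo_mulForm (hF Q hQ))).union ?_
      rcases d with _ | d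
      · simp
      · exact (finite_not_nonzeroUpTo_mulForm hQ'd).subset fun β hβ => hβ.2
    obtain ⟨β, hβ⟩ := hfin.exists_notMem
    simp only [Set.mem_union, Set.mem_iUnion, Set.mem_ofPred_eq, not_or, not_exists, not_and,
      not_not] at hβ
    obtain ⟨⟨hβE, hβF⟩, hβQ⟩ := hβ
    obtain ⟨P, hPm, hPd, hPF, hPc, hPr⟩ := ih (Q' :: F.map (fun Q => mulForm Q β)) (mulForm Q' β)
      (by
        intro Q hQ
        rcases List.mem_cons.mp hQ with rfl | hQ
        · exact hQ'd
        · obtain ⟨Q0, h0, rfl⟩ := List.mem_map.mp hQ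
          exact hβF Q0 h0) hβQ
    refine ⟨(X - C β) * P, (monic_X_sub_C β).mul hPm, ?_, ?_, ?_, ?_⟩
    · rw [(monic_X_sub_C β).natDegree_mul hPm, natDegree_X_sub_C, hPd, add_comm]
    · intro Q hQ
      exact hPF _ (List.mem_cons_of_mem _ (List.mem_map.mpr ⟨Q, hQ, rfl⟩))
    · intro h hh
      refine IsCoprime.mul_left ?_ (hPc h fun γ hγ => hh γ ?_)
      · refine (irreducible_X_sub_C β).coprime_iff_not_dvd.mpr ?_
        rw [dvd_iff_isRoot]
        exact hh β (by simp)
      · simp only [IsRoot, eval_mul] at hγ ⊢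
        rw [hγ, mul_zero]
    · intro γ hγ
      by_cases hγβ : γ = β
      · subst hγβ
        exact ⟨hβE, P, rfl, hPF _ List.mem_cons_self⟩
      · have hγP : P.IsRoot γ := by
          simp only [IsRoot, eval_mul, eval_sub, eval_X, eval_C, mul_eq_zero, sub_eq_zero] at hγ
          exact hγ.resolve_left hγβ
        obtain ⟨hγE, P', hP', hne⟩ := hPr γ hγP
        exact ⟨hγE, (X - C β) * P', by rw [hP']; ring, hne⟩

end GenericProducts

section FieldStep

variable {k ι : Type*} [Field k] [Fintype ι]

theorem natDegree_modByMonic_lt_natDegree {p : k[X]} (hp : p.Monic) (hn : 1 ≤ p.natDegree)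
    (r : k[X]) : (r %ₘ p).natDegree < p.natDegree := by
  refine natDegree_modByMonic_lt r hp fun h => ?_
  rw [h, natDegree_one] at hn
  omega

theorem X_sub_C_mul_modByMonic {p : k[X]} (hp : p.Monic) {r : k[X]}
    (hr : r.natDegree < p.natDegree) (β : k) :
    ((X - C β) * r) %ₘ p = (X - C β) * r - C (r.coeff (p.natDegree - 1)) * p := by
  have e : ((X - C β) * r) %ₘ p =
      ((X - C β) * r - C (r.coeff (p.natDegree - 1)) * p) %ₘ p := by
    refine modByMonic_eq_of_dvd_sub hp ?_
    rw [sub_sub_cancel]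
    exact dvd_mul_left _ _
  rw [e, modByMonic_eq_self_iff hp]
  refine degree_lt_degree ?_
  set r' := (X - C β) * r - C (r.coeff (p.natDegree - 1)) * p with hr'
  have h1 : r'.natDegree ≤ p.natDegree := by
    rw [← max_self p.natDegree]
    refine natDegree_sub_le_of_le ?_ (natDegree_C_mul_le _ _)
    exact (natDegree_mul_le_of_le (natDegree_X_sub_C_le _) le_rfl).trans (by omega)
  refine lt_of_le_of_ne h1 fun h2 => ?_
  have h3 : r'.coeff p.natDegree = 0 := by
    have hnn : p.natDegree = (p.natDegree - 1) + 1 := by omega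
    rw [hr', coeff_sub, coeff_C_mul, hp.coeff_natDegree, mul_one, sub_mul, coeff_sub,
      coeff_C_mul, coeff_eq_zero_of_natDegree_lt hr, mul_zero, sub_zero]
    conv_lhs =>
      enter [1]
      rw [hnn, coeff_X_mul]
    rw [sub_self]
  rw [← h2, coeff_natDegree, leadingCoeff_eq_zero] at h3
  rw [h3, natDegree_zero] at h2
  omega

theorem X_mul_modByMonic {p : k[X]} (hp : p.Monic) {r : k[X]}
    (hr : r.natDegree < p.natDegree) :
    (X * r) %ₘ p = X * r - C (r.coeff (p.natDegree - 1)) * p := by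
  have := X_sub_C_mul_modByMonic hp hr 0
  rwa [C_0, sub_zero] at this

theorem exists_coeff_functional {p : k[X]} (hp : p.Monic) (d : ℕ) (hd : d < p.natDegree) :
    ∃ g : k[X], g.natDegree ≤ d ∧ ∀ r : k[X], r.natDegree < p.natDegree →
      ((g * r) %ₘ p).coeff (p.natDegree - 1) = r.coeff (p.natDegree - 1 - d) := by
  induction d with
  | zero =>
    refine ⟨1, by simp, fun r hr => ?_⟩
    rw [one_mul, (modByMonic_eq_self_iff hp).mpr (degree_lt_degree hr), Nat.sub_zero]
  | succ d ih =>
    obtain ⟨g, hg, hgr⟩ := ih (by omega)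
    set n := p.natDegree with hn
    refine ⟨X * g + C (p.coeff (n - 1 - d)), ?_, fun r hr => ?_⟩
    · refine natDegree_add_le_of_degree_le ?_ (by simp)
      exact (natDegree_mul_le_of_le natDegree_X_le hg).trans (by omega)
    · have hr' := X_mul_modByMonic hp hr
      rw [← hn] at hr'
      have hr'd := natDegree_modByMonic_lt_natDegree hp (by omega) (X * r)
      set r' := (X * r) %ₘ p
      have hmod : ((X * g + C (p.coeff (n - 1 - d))) * r) %ₘ p =
          (g * r') %ₘ p + C (p.coeff (n - 1 - d)) * r := by
        have e : (X * g + C (p.coeff (n - 1 - d))) * r =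
            (g * r' + C (p.coeff (n - 1 - d)) * r) + p * (C (r.coeff (n - 1)) * g) := by
          rw [hr']; ring
        rw [e, add_modByMonic, add_modByMonic, self_mul_modByMonic hp, add_zero,
          ← smul_eq_C_mul, smul_modByMonic,
          (modByMonic_eq_self_iff (p := r) hp).mpr (degree_lt_degree hr)]
      rw [hmod, coeff_add, hgr r' hr'd, hr', coeff_sub, coeff_C_mul, coeff_C_mul]
      have h5 : n - 1 - d = (n - 1 - (d + 1)) + 1 := by omega
      conv_lhs =>
        enter [1, 1]
        rw [h5, coeff_X_mul]
      ring

/-- A linear functional of the coefficients of index at least `m` of the remainder modulo `p` is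
the top coefficient of the remainder of a multiple. -/
theorem exists_functional {p : k[X]} (hp : p.Monic) (hp1 : 1 ≤ p.natDegree) (m : ℕ)
    (Λ : k[X] →ₗ[k] k) :
    ∃ g : k[X], g.natDegree ≤ p.natDegree - 1 - m ∧ ∀ r : k[X],
      ((g * r) %ₘ p).coeff (p.natDegree - 1) = Λ (divX^[m] (r %ₘ p)) := by
  have h : ∀ d : ℕ, ∃ g : k[X], g.natDegree ≤ d ∧ (d < p.natDegree → ∀ r : k[X],
      r.natDegree < p.natDegree →
      ((g * r) %ₘ p).coeff (p.natDegree - 1) = r.coeff (p.natDegree - 1 - d)) := by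
    intro d
    by_cases hd : d < p.natDegree
    · obtain ⟨g, h1, h2⟩ := exists_coeff_functional hp d hd
      exact ⟨g, h1, fun _ => h2⟩
    · exact ⟨0, by simp, fun h => absurd h hd⟩
  choose g hg1 hg2 using h
  set n := p.natDegree with hn
  refine ⟨∑ j ∈ Finset.range (n - m), C (Λ (X ^ j)) * g (n - 1 - (j + m)), ?_, fun r => ?_⟩
  · refine natDegree_sum_le_of_forall_le _ _ fun j _ => (natDegree_C_mul_le _ _).trans
      ((hg1 _).trans (by omega))
  · have hdeg : (r %ₘ p).natDegree < n := by
      refine natDegree_modByMonic_lt r hp fun h => ?_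
      rw [h, natDegree_one] at hn; omega
    have hcd : ∀ (m j : ℕ) (r : k[X]), (divX^[m] r).coeff j = r.coeff (j + m) := by
      intro m
      induction m with
      | zero => intro j r; rfl
      | succ m ih => intro j r; rw [Function.iterate_succ_apply, ih, coeff_divX]; congr 1
    have hr : divX^[m] (r %ₘ p) =
        ∑ j ∈ Finset.range (n - m), (r %ₘ p).coeff (j + m) • X ^ j := by
      ext i
      rw [hcd]
      simp only [finsetSum_coeff, coeff_smul, coeff_X_pow, smul_eq_mul, mul_ite, mul_one, mul_zero]
      rw [Finset.sum_ite_eq]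
      split_ifs with hi
      · rfl
      · refine coeff_eq_zero_of_natDegree_lt (hdeg.trans_le ?_)
        rw [Finset.mem_range] at hi; omega
    rw [hr, map_sum, Finset.sum_mul]
    have hmod : ∀ s : Finset ℕ, ∀ F : ℕ → k[X], (∑ j ∈ s, F j) %ₘ p = ∑ j ∈ s, F j %ₘ p := by
      intro s F
      exact map_sum (modByMonicHom p) F s
    rw [hmod, finsetSum_coeff]
    refine Finset.sum_congr rfl fun j hj => ?_
    rw [Finset.mem_range] at hj
    rw [mul_assoc, ← smul_eq_C_mul, smul_modByMonic, coeff_smul, map_smul, smul_eq_mul,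
      smul_eq_mul, mul_modByMonic, mul_comm]
    have e : ((g (n - 1 - (j + m)) %ₘ p) * (r %ₘ p)) %ₘ p
        = (g (n - 1 - (j + m)) * (r %ₘ p)) %ₘ p := by
      refine modByMonic_eq_of_dvd_sub hp ?_
      rw [← sub_mul]
      exact (dvd_modByMonic_sub _ _).mul_right _
    rw [e, hg2 _ (by omega) _ hdeg]
    congr 2
    omega

/-- The form `g ↦ q(c)`, where `c` is the coefficient of index `j` of the remainder of `g v`
modulo `p`. -/
noncomputable def coeffForm (B : Matrix ι ι k) (p : k[X]) (v : ι → k[X]) (j : ℕ) :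
    QuadraticForm k k[X] :=
  (gramForm B).comp (LinearMap.pi fun i =>
    (lcoeff k j).comp ((modByMonicHom p).comp (LinearMap.mulRight k (v i))))

theorem coeffForm_apply (B : Matrix ι ι k) (p : k[X]) (v : ι → k[X]) (j : ℕ) (g : k[X]) :
    coeffForm B p v j g = gramForm B (fun i => ((g * v i) %ₘ p).coeff j) := rfl

theorem coeffForm_congr (B : Matrix ι ι k) {p : k[X]} (hp : p.Monic) {v w : ι → k[X]}
    (h : ∀ i, p ∣ v i - w i) (j : ℕ) : coeffForm B p v j = coeffForm B p w j := by
  ext g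
  rw [coeffForm_apply, coeffForm_apply]
  congr 1
  funext i
  rw [modByMonic_eq_of_dvd_sub hp (p₂ := g * w i)]
  rw [← mul_sub]
  exact (h i).mul_left _

variable [Infinite k]

theorem polyForm_eq_zero_of_eval {B : Matrix ι ι k} {x : ι → k[X]}
    (h : ∀ c, gramForm B (fun i => (x i).eval c) = 0) : polyForm B x = 0 := by
  refine funext fun c => ?_
  rw [eval_polyForm, h, eval_zero]

/-- If the top coefficient form vanishes in low degrees, then `q(w) = X` holds exactly for the
remainder `w = e + X y` of `v`. -/
theorem hyperbolic_of_coeffForm_eq_zero {B : Matrix ι ι k} {p : k[X]} (hp : p.Monic)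
    (hn : 2 ≤ p.natDegree) {v : ι → k[X]} (hv : p ∣ polyForm B v - X)
    (h : ¬ NonzeroUpTo (coeffForm B p v (p.natDegree - 1)) (p.natDegree - 2)) :
    (∀ Λ : k[X] →ₗ[k] k, gramForm B (fun i => Λ (divX (v i %ₘ p))) = 0) ∧
    polyForm B (fun i => v i %ₘ p) = X ∧
    polyForm B (fun i => C ((v i %ₘ p).coeff 0)) = 0 ∧
    polyForm B (fun i => divX (v i %ₘ p)) = 0 ∧
    QuadraticMap.polar (polyForm B) (fun i => C ((v i %ₘ p).coeff 0))
      (fun i => divX (v i %ₘ p)) = 1 := by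
  have hΛ : ∀ Λ : k[X] →ₗ[k] k, gramForm B (fun i => Λ (divX (v i %ₘ p))) = 0 := by
    intro Λ
    obtain ⟨g, hg, hgr⟩ := exists_functional hp (by omega) 1 Λ
    by_contra hne
    refine h ⟨g, hg.trans (by omega), ?_⟩
    rw [coeffForm_apply]
    simp only [hgr]
    exact hne
  have hy : polyForm B (fun i => divX (v i %ₘ p)) = 0 :=
    polyForm_eq_zero_of_eval fun c => hΛ (leval c)
  set y : ι → k[X] := fun i => divX (v i %ₘ p) with hydef
  set e : ι → k[X] := fun i => C ((v i %ₘ p).coeff 0) with hedef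
  have hdeg : ∀ i, (v i %ₘ p).natDegree < p.natDegree := fun i =>
    natDegree_modByMonic_lt_natDegree hp (by omega) (v i)
  have hw : (fun i => v i %ₘ p) = e + (X : k[X]) • y := by
    funext i
    simp only [Pi.add_apply, Pi.smul_apply, smul_eq_mul, hydef, hedef]
    rw [add_comm, X_mul_divX_add]
  have hQe : polyForm B e = C (gramForm B (fun i => (v i %ₘ p).coeff 0)) := by
    have h1 := map_gramForm C B (fun i => (v i %ₘ p).coeff 0)
    rw [h1]
  have hQw : polyForm B (fun i => v i %ₘ p) =
      polyForm B e + X * QuadraticMap.polar (polyForm B) e y := by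
    rw [hw, QuadraticMap.map_add (polyForm B), QuadraticMap.map_smul, hy, smul_zero, add_zero,
      QuadraticMap.polar_smul_right, smul_eq_mul]
  have hpd : (QuadraticMap.polar (polyForm B) e y).natDegree ≤ p.natDegree - 2 := by
    have hb : QuadraticMap.polar (polyForm B) e y =
        ∑ i, ∑ j, (e i * (B.map C) i j * y j + y i * (B.map C) i j * e j) := by
      simp only [QuadraticMap.polar, gramForm_apply, Pi.add_apply, ← Finset.sum_sub_distrib]
      exact Finset.sum_congr rfl fun i _ => Finset.sum_congr rfl fun j _ => by ring
    rw [hb]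
    have hyd : ∀ i, (y i).natDegree ≤ p.natDegree - 2 := by
      intro i
      change (divX (v i %ₘ p)).natDegree ≤ _
      rw [natDegree_divX_eq_natDegree_tsub_one]
      have := hdeg i
      omega
    refine natDegree_sum_le_of_forall_le _ _ fun i _ => natDegree_sum_le_of_forall_le _ _ fun j _ => ?_
    refine natDegree_add_le_of_degree_le ?_ ?_
    · simp only [hedef, Matrix.map_apply, ← C_mul]
      exact (natDegree_C_mul_le _ _).trans (hyd j)
    · simp only [hedef, Matrix.map_apply, mul_assoc, ← C_mul]
      exact (natDegree_mul_C_le _ _).trans (hyd i)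
  have hX : polyForm B (fun i => v i %ₘ p) = X := by
    rw [← sub_eq_zero]
    refine eq_zero_of_dvd_of_natDegree_lt (p := p) ?_ ?_
    · have h1 : p ∣ polyForm B (fun i => v i %ₘ p) - polyForm B v :=
        dvd_gramForm_sub fun i => dvd_modByMonic_sub _ _
      have h2 := dvd_add h1 hv
      rwa [sub_add_sub_cancel] at h2
    · refine lt_of_le_of_lt (b := p.natDegree - 1) ?_ (by omega)
      rw [hQw, hQe]
      refine (natDegree_sub_le _ _).trans (max_le (natDegree_add_le_of_degree_le (by simp) ?_)
        (natDegree_X_le.trans (by omega)))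
      exact (natDegree_mul_le_of_le natDegree_X_le hpd).trans (by omega)
  have hsum := hQw.symm.trans hX
  rw [hQe] at hsum
  have h0 := congrArg (fun r => coeff r 0) hsum
  simp at h0
  have hQe0 : polyForm B e = 0 := by rw [hQe, h0, C_0]
  refine ⟨hΛ, hX, hQe0, hy, ?_⟩
  rw [h0, C_0, zero_add] at hsum
  exact mul_left_cancel₀ X_ne_zero (hsum.trans (mul_one X).symm)

theorem exists_reflection {B : Matrix ι ι k} {p : k[X]} (hp : p.Monic) (hn : 2 ≤ p.natDegree)
    (hp0 : p.coeff 0 ≠ 0) {v : ι → k[X]} (hv : p ∣ polyForm B v - X) :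
    ∃ x : ι → k[X], IsCoprime (polyForm B x) p ∧ ∀ s : k[X], p ∣ s * polyForm B x - 1 →
      NonzeroUpTo (coeffForm B p (v - (s * QuadraticMap.polar (polyForm B) x v) • x)
        (p.natDegree - 1)) (p.natDegree - 2) := by
  have hXp : IsCoprime (X : k[X]) p := by
    refine irreducible_X.coprime_iff_not_dvd.mpr ?_
    rwa [X_dvd_iff]
  have hcop : ∀ {a b : k[X]}, p ∣ a - b → IsCoprime b p → IsCoprime a p := by
    rintro a b ⟨c, hc⟩ h
    rw [sub_eq_iff_eq_add'.mp hc]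
    exact h.add_mul_left_left c
  by_cases hex : NonzeroUpTo (coeffForm B p v (p.natDegree - 1)) (p.natDegree - 2)
  · refine ⟨v, hcop hv hXp, fun s hs => ?_⟩
    have hneg : coeffForm B p (v - (s * QuadraticMap.polar (polyForm B) v v) • v)
        (p.natDegree - 1) = coeffForm B p (-v) (p.natDegree - 1) := by
      refine coeffForm_congr B hp (fun i => ?_) _
      rw [QuadraticMap.polar_self]
      obtain ⟨c, hc⟩ := hs
      refine ⟨-2 * c * v i, ?_⟩
      simp only [Pi.sub_apply, Pi.smul_apply, Pi.neg_apply, nsmul_eq_mul, smul_eq_mul]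
      push_cast
      linear_combination -2 * v i * hc
    rw [hneg]
    obtain ⟨g, hg, hgne⟩ := hex
    refine ⟨-g, by rwa [natDegree_neg], ?_⟩
    rw [coeffForm_apply] at hgne ⊢
    simpa using hgne
  obtain ⟨hΛ, hX, hQe, hQy, hb⟩ := hyperbolic_of_coeffForm_eq_zero hp hn hv hex
  set w : ι → k[X] := fun i => v i %ₘ p with hwdef
  set y : ι → k[X] := fun i => divX (v i %ₘ p) with hydef
  set e : ι → k[X] := fun i => C ((v i %ₘ p).coeff 0) with hedef
  have hw : w = (1 : k[X]) • e + (X : k[X]) • y := by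
    funext i
    simp only [Pi.add_apply, Pi.smul_apply, smul_eq_mul, hydef, hedef, hwdef, one_mul]
    rw [add_comm, X_mul_divX_add]
  have hvw : ∀ i, p ∣ v i - w i := fun i => by
    rw [← neg_sub]; exact (dvd_modByMonic_sub _ _).neg_right
  obtain ⟨c, hc⟩ : ∃ c : k, c ≠ 0 ∧ p.eval (-c) ≠ 0 ∧ p.eval (1 - c) ≠ 0 := by
    have hne : X * p.comp (-X) * p.comp (1 - X) ≠ 0 := by
      have hl : ∀ a : k[X], a.natDegree = 1 → p.comp a ≠ 0 := by
        intro a ha h0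
        have := natDegree_comp (p := p) (q := a)
        rw [h0, ha, natDegree_zero] at this
        omega
      refine mul_ne_zero (mul_ne_zero X_ne_zero (hl _ (by simp))) (hl _ ?_)
      rw [← neg_sub, natDegree_neg, ← C_1, natDegree_X_sub_C]
    by_contra hcon
    push Not at hcon
    refine hne (funext fun c => ?_)
    simp only [eval_mul, eval_X, eval_comp, eval_neg, eval_sub, eval_one, eval_zero]
    by_cases h1 : c = 0
    · simp [h1]
    by_cases h2 : p.eval (-c) = 0
    · simp [h2]
    · simp [hcon c h1 h2]
  obtain ⟨hc0, hpc, hpc1⟩ := hc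
  have hlin : ∀ b : k, p.eval b ≠ 0 → IsCoprime (X - C b) p := by
    intro b hb
    refine (irreducible_X_sub_C b).coprime_iff_not_dvd.mpr ?_
    rwa [dvd_iff_isRoot]
  set l : k[X] := X - C (-c) with hl
  obtain ⟨μ, ν, hμ⟩ := hlin (-c) hpc
  rw [← hl] at hμ
  set v2 : ι → k[X] := l • e + (μ * X) • y with hv2
  have hQv2 : polyForm B v2 = l * (μ * X) := by
    rw [hv2, map_smul_add_smul _ _ _ _ _ hQe hQy, hb, mul_one]
  have hv2X : p ∣ polyForm B v2 - X := by
    refine ⟨-ν * X, ?_⟩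
    rw [hQv2]
    linear_combination X * hμ
  have hbw : QuadraticMap.polar (polyForm B) w v2 = μ * X + X * l := by
    rw [hw, hv2, polar_add_smul_add_smul _ _ _ _ _ _ _ hQe hQy, hb]
    ring
  have hQx : polyForm B (w - v2) = X + l * (μ * X) - (μ * X + X * l) := by
    rw [sub_eq_add_neg, QuadraticMap.map_add (polyForm B), QuadraticMap.map_neg,
      QuadraticMap.polar_neg_right, hX, hQv2, hbw]
    ring
  have hnon2 : NonzeroUpTo (coeffForm B p v2 (p.natDegree - 1)) (p.natDegree - 2) := by
    by_contra hex2
    obtain ⟨-, hX2, -⟩ := hyperbolic_of_coeffForm_eq_zero hp hn hv2X hex2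
    have h1 := congrArg (eval (-c)) hX2
    rw [eval_polyForm, eval_X] at h1
    have h2 : (fun i => (v2 i %ₘ p).eval (-c)) =
        fun i => ((leval (-c)).comp ((modByMonicHom p).comp (LinearMap.mulLeft k (μ * X))))
          (divX (v i %ₘ p)) := by
      funext i
      have e1 : v2 i = l * C ((v i %ₘ p).coeff 0) + (μ * X) * divX (v i %ₘ p) := rfl
      have e2 : (l * C ((v i %ₘ p).coeff 0)) %ₘ p = l * C ((v i %ₘ p).coeff 0) := by
        rw [modByMonic_eq_self_iff hp]
        refine degree_lt_degree (lt_of_le_of_lt (natDegree_mul_C_le _ _) ?_)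
        rw [hl, natDegree_X_sub_C]; omega
      rw [e1, add_modByMonic, e2, eval_add, eval_mul, hl, eval_sub, eval_X, eval_C, sub_self,
        zero_mul, zero_add]
      rfl
    rw [h2, hΛ] at h1
    exact hc0 (neg_eq_zero.mp h1.symm)
  refine ⟨w - v2, ?_, fun s hs => ?_⟩
  · have h1 : IsCoprime (l * polyForm B (w - v2)) p := by
      refine hcop (b := -(X * ((X - C (1 - c)) * (X - C (1 - c))))) ?_ ?_
      · rw [hQx]
        refine ⟨-ν * X * l + ν * X, ?_⟩
        have hl' : X - C (1 - c) = l - 1 := by rw [hl]; simp; ring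
        rw [hl']
        linear_combination (X * l - X) * hμ
      · exact (hXp.mul_left ((hlin _ hpc1).mul_left (hlin _ hpc1))).neg_left
    exact h1.of_mul_left_right
  · rw [coeffForm_congr B hp (w := v2)]
    · exact hnon2
    · intro i
      have hpol : p ∣ QuadraticMap.polar (polyForm B) (w - v2) v -
          QuadraticMap.polar (polyForm B) (w - v2) w := by
        choose t ht using hvw
        have : v = w + p • t := by
          funext i
          simp only [Pi.add_apply, Pi.smul_apply, smul_eq_mul, ← ht]
          ring
        rw [this, QuadraticMap.polar_add_right, QuadraticMap.polar_smul_right, add_sub_cancel_left]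
        exact dvd_mul_right _ _
      have hpol2 : p ∣ QuadraticMap.polar (polyForm B) (w - v2) w - polyForm B (w - v2) := by
        rw [hQx, sub_eq_add_neg w, QuadraticMap.polar_add_left, QuadraticMap.polar_neg_left,
          QuadraticMap.polar_self, QuadraticMap.polar_comm _ v2 w, hbw, hX]
        refine ⟨ν * X, ?_⟩
        rw [nsmul_eq_mul]
        push_cast
        linear_combination -X * hμ
      have hpol3 := dvd_add hpol hpol2
      rw [sub_add_sub_cancel] at hpol3
      have h4 := dvd_add (hpol3.mul_left s) hs
      obtain ⟨t, ht⟩ := h4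
      obtain ⟨t', ht'⟩ := hvw i
      refine ⟨t' - t * (w i - v2 i), ?_⟩
      simp only [Pi.sub_apply, Pi.smul_apply, smul_eq_mul]
      linear_combination ht' - (w i - v2 i) * ht

/-- The polynomial by which the induction replaces `p`. -/
noncomputable def cofactor {A : Type*} [CommRing A] (B : Matrix ι ι A) (p f : A[X])
    (v : ι → A[X]) : A[X] :=
  (X * f ^ 2 - polyForm B (fun i => (f * v i) %ₘ p)) /ₘ p

theorem mul_cofactor {A : Type*} [CommRing A] {B : Matrix ι ι A} {p : A[X]} (hp : p.Monic)
    (f : A[X]) {v : ι → A[X]} (hv : p ∣ polyForm B v - X) :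
    p * cofactor B p f v = X * f ^ 2 - polyForm B (fun i => (f * v i) %ₘ p) := by
  have h1 : p ∣ polyForm B (fun i => (f * v i) %ₘ p) - polyForm B (f • v) :=
    dvd_gramForm_sub fun i => dvd_modByMonic_sub _ _
  rw [QuadraticMap.map_smul, smul_eq_mul] at h1
  have h2 : p ∣ X * f ^ 2 - polyForm B (fun i => (f * v i) %ₘ p) := by
    have h3 := dvd_add h1 (hv.mul_left (f * f))
    rw [← dvd_neg] at h3
    convert h3 using 1
    ring
  have h4 := modByMonic_add_div (X * f ^ 2 - polyForm B (fun i => (f * v i) %ₘ p)) p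
  rwa [(modByMonic_eq_zero_iff_dvd hp).mpr h2, zero_add] at h4

theorem exists_multiplier {B : Matrix ι ι k} {p : k[X]} (hp : p.Monic) (hn : 2 ≤ p.natDegree)
    (hp0 : p.coeff 0 ≠ 0) {v : ι → k[X]} (hv : p ∣ polyForm B v - X)
    (hex : NonzeroUpTo (coeffForm B p v (p.natDegree - 1)) (p.natDegree - 2)) :
    ∃ f : k[X], f.Monic ∧ f.natDegree = p.natDegree - 1 ∧
      gramForm B (fun i => ((f * v i) %ₘ p).coeff 0) ≠ 0 ∧ IsCoprime f (cofactor B p f v) := by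
  have hQ0 : NonzeroUpTo (coeffForm B p v 0) (p.natDegree - 1) := by
    by_contra hcon
    have hall : ∀ g, coeffForm B p v 0 g = 0 := by
      intro g
      by_contra hne
      refine hcon ⟨g %ₘ p, ?_, ?_⟩
      · have := natDegree_modByMonic_lt_natDegree hp (by omega) g
        omega
      · rw [coeffForm_apply] at hne ⊢
        convert hne using 4 with i
        refine modByMonic_eq_of_dvd_sub hp ?_
        rw [← sub_mul]
        exact (dvd_modByMonic_sub _ _).mul_right _
    have hzero : polyForm B (fun i => v i %ₘ p) = 0 := by
      refine polyForm_eq_zero_of_eval fun c => ?_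
      obtain ⟨g, -, hg⟩ := exists_functional hp (by omega) 0 (leval c)
      have h1 := hall (C (-(p.coeff 0)⁻¹) * (X * g))
      rw [coeffForm_apply] at h1
      convert h1 using 2
      funext i
      have h2 := hg (v i)
      simp only [Function.iterate_zero, id, leval_apply] at h2
      rw [← h2]
      set r := (g * v i) %ₘ p with hr
      have hrd : r.natDegree < p.natDegree :=
        natDegree_modByMonic_lt_natDegree hp (by omega) _
      have h3 : (C (-(p.coeff 0)⁻¹) * (X * g) * v i) %ₘ p =
          C (-(p.coeff 0)⁻¹) * (X * r - C (r.coeff (p.natDegree - 1)) * p) := by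
        rw [← X_mul_modByMonic hp hrd, ← smul_eq_C_mul, ← smul_eq_C_mul, smul_mul_assoc,
          smul_modByMonic]
        congr 1
        refine modByMonic_eq_of_dvd_sub hp ?_
        rw [mul_assoc, ← mul_sub, ← neg_sub r (g * v i)]
        exact (dvd_neg.mpr (dvd_modByMonic_sub (g * v i) p)).mul_left _
      rw [h3, coeff_C_mul, coeff_sub, coeff_X_mul_zero, coeff_C_mul]
      field_simp
      ring
    have h1 : p ∣ polyForm B (fun i => v i %ₘ p) - polyForm B v :=
      dvd_gramForm_sub fun i => dvd_modByMonic_sub _ _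
    have h2 := dvd_add h1 hv
    rw [sub_add_sub_cancel, hzero, zero_sub, dvd_neg] at h2
    have := natDegree_le_of_dvd h2 X_ne_zero
    rw [natDegree_X] at this
    omega
  have hE : {β : k | p.IsRoot β}.Finite := by
    by_contra hinf
    exact hp.ne_zero (eq_zero_of_infinite_isRoot p hinf)
  obtain ⟨f, hfm, hfd, hfQ, hfc, hfr⟩ := exists_split_monic {β : k | p.IsRoot β} hE
    (p.natDegree - 1) [coeffForm B p v 0] (coeffForm B p v (p.natDegree - 1))
    (by simpa using hQ0) (fun _ => by rwa [Nat.sub_sub])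
  refine ⟨f, hfm, hfd, hfQ _ (List.mem_singleton_self _), hfc _ fun β hβ hz => ?_⟩
  obtain ⟨hβp, g, hg, hgne⟩ := hfr β hβ
  apply hgne
  have h1 := congrArg (eval β) (mul_cofactor hp f hv)
  rw [eval_mul, hz, mul_zero, eval_sub, eval_mul, eval_pow, hβ.eq_zero, eval_polyForm] at h1
  have h2 : (fun i => ((f * v i) %ₘ p).eval β) =
      (-(p.eval β)) • fun i => ((g * v i) %ₘ p).coeff (p.natDegree - 1) := by
    funext i
    set r := (g * v i) %ₘ p with hr
    have hrd : r.natDegree < p.natDegree :=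
      natDegree_modByMonic_lt_natDegree hp (by omega) _
    have h3 : (f * v i) %ₘ p = (X - C β) * r - C (r.coeff (p.natDegree - 1)) * p := by
      rw [← X_sub_C_mul_modByMonic hp hrd]
      refine modByMonic_eq_of_dvd_sub hp ?_
      rw [hg, mul_assoc, ← mul_sub, ← neg_sub r (g * v i)]
      exact (dvd_neg.mpr (dvd_modByMonic_sub (g * v i) p)).mul_left _
    rw [h3, Pi.smul_apply, smul_eq_mul, eval_sub, eval_mul, eval_mul, eval_sub, eval_X, eval_C,
      eval_C, sub_self]
    ring
  rw [h2, QuadraticMap.map_smul, smul_eq_mul] at h1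
  have hp' : p.eval β ≠ 0 := hβp
  rw [coeffForm_apply]
  by_contra hne
  have : -p.eval β * -p.eval β * gramForm B (fun i => ((g * v i) %ₘ p).coeff (p.natDegree - 1)) = 0 := by
    linear_combination h1
  rw [mul_eq_zero] at this
  rcases this with h | h
  · exact hp' (by simpa using h)
  · exact hne h

theorem exists_reflection_and_multiplier {B : Matrix ι ι k} {p : k[X]} (hp : p.Monic)
    (hn : 2 ≤ p.natDegree) (hp0 : p.coeff 0 ≠ 0) {v : ι → k[X]} (hv : p ∣ polyForm B v - X) :
    ∃ (x : ι → k[X]) (f : k[X]), IsCoprime (polyForm B x) p ∧ f.Monic ∧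
      f.natDegree = p.natDegree - 1 ∧ ∀ s : k[X], p ∣ s * polyForm B x - 1 → ∀ v1,
        v1 = v - (s * QuadraticMap.polar (polyForm B) x v) • x →
        gramForm B (fun i => ((f * v1 i) %ₘ p).coeff 0) ≠ 0 ∧
          IsCoprime f (cofactor B p f v1) := by
  obtain ⟨x, hx, hxs⟩ := exists_reflection hp hn hp0 hv
  obtain ⟨s0, t0, hst⟩ := id hx
  have hs0 : p ∣ s0 * polyForm B x - 1 := ⟨-t0, by linear_combination hst⟩
  have hv1 : p ∣ polyForm B (v - (s0 * QuadraticMap.polar (polyForm B) x v) • x) - X := by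
    rw [map_sub_smul_polar, add_sub_right_comm]
    exact dvd_add hv (hs0.mul_left _)
  obtain ⟨f, hfm, hfd, hf1, hf2⟩ := exists_multiplier hp hn hp0 hv1 (hxs s0 hs0)
  refine ⟨x, f, hx, hfm, hfd, fun s hs v1 hv1' => ?_⟩
  have hss : p ∣ s - s0 := by
    refine (hx.symm).dvd_of_dvd_mul_right ?_
    have := dvd_sub hs hs0
    convert this using 1
    ring
  have hmod : ∀ i, (f * v1 i) %ₘ p =
      (f * (v - (s0 * QuadraticMap.polar (polyForm B) x v) • x) i) %ₘ p := by
    intro i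
    refine modByMonic_eq_of_dvd_sub hp ?_
    obtain ⟨c, hc⟩ := hss
    refine ⟨-(f * c * QuadraticMap.polar (polyForm B) x v * x i), ?_⟩
    rw [hv1']
    simp only [Pi.sub_apply, Pi.smul_apply, smul_eq_mul]
    linear_combination (-f * QuadraticMap.polar (polyForm B) x v * x i) * hc
  have hcof : cofactor B p f v1 =
      cofactor B p f (v - (s0 * QuadraticMap.polar (polyForm B) x v) • x) := by
    simp only [cofactor, hmod]
  rw [hcof]
  simp only [hmod]
  exact ⟨hf1, hf2⟩

end FieldStep

section Semilocal

variable {R : Type*} [CommRing R]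

theorem isUnit_of_forall_mk_ne_zero {r : R}
    (h : ∀ m : MaximalSpectrum R, Ideal.Quotient.mk m.asIdeal r ≠ 0) : IsUnit r := by
  by_contra hr
  obtain ⟨m, hm, hrm⟩ := exists_max_ideal_of_mem_nonunits hr
  exact h ⟨m, hm⟩ (Ideal.Quotient.eq_zero_iff_mem.mpr hrm)

/-- A monic polynomial is coprime to `g` if it is so modulo every maximal ideal. -/
theorem isCoprime_of_forall_map {f g : R[X]} (hf : f.Monic)
    (h : ∀ m : MaximalSpectrum R, IsCoprime (f.map (Ideal.Quotient.mk m.asIdeal))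
      (g.map (Ideal.Quotient.mk m.asIdeal))) : IsCoprime f g := by
  have hu : IsUnit (AdjoinRoot.mk f g) := by
    by_contra hu
    obtain ⟨M, hM, hgM⟩ := exists_max_ideal_of_mem_nonunits hu
    have := hf.finite_adjoinRoot
    have hm := Ideal.isMaximal_comap_of_isIntegral_of_isMaximal (R := R) M
    obtain ⟨a, b, hab⟩ := h ⟨_, hm⟩
    let ψ : (R ⧸ M.comap (algebraMap R (AdjoinRoot f)))[X] →+* AdjoinRoot f ⧸ M :=
      eval₂RingHom (Ideal.Quotient.lift _
        ((Ideal.Quotient.mk M).comp (algebraMap R (AdjoinRoot f)))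
        (fun r hr => Ideal.Quotient.eq_zero_iff_mem.mpr hr)) (Ideal.Quotient.mk M (AdjoinRoot.root f))
    have hψ : ∀ r : R[X], ψ (r.map (Ideal.Quotient.mk _)) =
        Ideal.Quotient.mk M (AdjoinRoot.mk f r) := by
      intro r
      have h1 : ψ.comp (mapRingHom (Ideal.Quotient.mk _)) =
          (Ideal.Quotient.mk M).comp (AdjoinRoot.mk f) := by
        refine ringHom_ext (fun a => ?_) ?_
        · change eval₂ _ _ ((C a).map _) = _
          rw [map_C, eval₂_C]
          rfl
        · change eval₂ _ _ (X.map _) = _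
          rw [map_X, eval₂_X]
          rfl
      exact congrArg (fun φ => φ r) h1
    have h1 := congrArg ψ hab
    rw [map_add, map_mul, map_mul, map_one, hψ, hψ, AdjoinRoot.mk_self, map_zero, mul_zero,
      Ideal.Quotient.eq_zero_iff_mem.mpr hgM, mul_zero, add_zero] at h1
    exact zero_ne_one h1
  obtain ⟨b, hb⟩ := hu.exists_right_inv
  obtain ⟨b, rfl⟩ := AdjoinRoot.mk_surjective b
  rw [← map_mul, ← map_one (AdjoinRoot.mk f), AdjoinRoot.mk_eq_mk] at hb
  obtain ⟨c, hc⟩ := hb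
  exact ⟨-c, b, by linear_combination hc⟩

variable [Finite (MaximalSpectrum R)]

theorem exists_forall_mk_eq (x : ∀ m : MaximalSpectrum R, R ⧸ m.asIdeal) :
    ∃ r : R, ∀ m : MaximalSpectrum R, Ideal.Quotient.mk m.asIdeal r = x m :=
  Ideal.pi_quotient_surjective (I := fun m : MaximalSpectrum R => m.asIdeal)
    (fun _ _ hne => Ideal.isCoprime_of_isMaximal (MaximalSpectrum.ext_iff.ne.mp hne)) x

theorem exists_forall_map_eq {d : ℕ} (F : ∀ m : MaximalSpectrum R, (R ⧸ m.asIdeal)[X])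
    (hF : ∀ m, (F m).degree < d) :
    ∃ f : R[X], f.degree < d ∧
      ∀ m : MaximalSpectrum R, f.map (Ideal.Quotient.mk m.asIdeal) = F m := by
  choose r hr using fun j : ℕ => exists_forall_mk_eq fun m => (F m).coeff j
  refine ⟨∑ j ∈ Finset.range d, monomial j (r j), ?_, fun m => ?_⟩
  · rw [degree_lt_iff_coeff_zero]
    intro j hj
    rw [finsetSum_coeff]
    refine Finset.sum_eq_zero fun i hi => coeff_monomial_of_ne _ ?_
    rw [Finset.mem_range] at hi
    omega
  · have h := (degree_lt_iff_coeff_zero (F m) d).mp (hF m)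
    ext j
    simp only [coeff_map, finsetSum_coeff, coeff_monomial, Finset.sum_ite_eq', Finset.mem_range]
    split_ifs with hj
    · exact hr j m
    · rw [map_zero, h j (not_lt.mp hj)]

theorem exists_forall_map_eq_of_finite (F : ∀ m : MaximalSpectrum R, (R ⧸ m.asIdeal)[X]) :
    ∃ f : R[X], ∀ m : MaximalSpectrum R, f.map (Ideal.Quotient.mk m.asIdeal) = F m := by
  cases nonempty_fintype (MaximalSpectrum R)
  obtain ⟨f, -, hf⟩ := exists_forall_map_eq
    (d := (Finset.univ.sup fun m : MaximalSpectrum R => (F m).natDegree) + 1) F fun m => by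
      refine degree_le_natDegree.trans_lt ?_
      exact_mod_cast Nat.lt_succ_of_le
        (Finset.le_sup (f := fun m : MaximalSpectrum R => (F m).natDegree) (Finset.mem_univ m))
  exact ⟨f, hf⟩

theorem exists_monic_forall_map_eq {d : ℕ} (F : ∀ m : MaximalSpectrum R, (R ⧸ m.asIdeal)[X])
    (hF : ∀ m, (F m).Monic) (hd : ∀ m, (F m).natDegree = d) :
    ∃ f : R[X], (f - X ^ d).degree < (d : WithBot ℕ) ∧
      ∀ m : MaximalSpectrum R, f.map (Ideal.Quotient.mk m.asIdeal) = F m := by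
  obtain ⟨g, hg, hgF⟩ := exists_forall_map_eq (d := d) (fun m => F m - X ^ d) fun m => by
    have := Ideal.Quotient.nontrivial_iff.mpr m.isMaximal.ne_top
    have h1 : (F m).degree = d := by rw [degree_eq_natDegree (hF m).ne_zero, hd m]
    rw [← h1]
    exact degree_sub_lt_left (by rw [h1, degree_X_pow]) (hF m).ne_zero
      (by rw [(hF m).leadingCoeff, (monic_X_pow d).leadingCoeff])
  refine ⟨X ^ d + g, by simpa using hg, fun m => ?_⟩
  rw [Polynomial.map_add, Polynomial.map_pow, map_X, hgF]
  ring

variable {ι : Type*} [Fintype ι]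

/-- If the class of `X` is represented over `R[X] / (p)`, with `p` monic of degree `n`, then
the norm of this class is a product of represented units, of length congruent to `n`. -/
theorem exists_list_prod_eq (hinf : ∀ m : Ideal R, m.IsMaximal → Infinite (R ⧸ m))
    (B : Matrix ι ι R) (n : ℕ) : ∀ (p : R[X]) (v : ι → R[X]), p.Monic → p.natDegree = n →
      IsUnit (p.coeff 0) → p ∣ polyForm B v - X →
      ∃ l : List Rˣ, (∀ x ∈ l, Represents (gramForm B) x) ∧ l.length ≡ n [MOD 2] ∧
        (l.prod : R) = (-1) ^ n * p.coeff 0 ∧ (n ≠ 0 → l ≠ []) := by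
  induction n with
  | zero =>
    intro p v hp hn _ _
    rw [eq_one_of_monic_natDegree_zero hp hn]
    exact ⟨[], by simp, rfl, by simp, fun h => absurd rfl h⟩
  | succ n ih =>
    intro p v hp hn hp0 hv
    rcases Nat.eq_zero_or_pos n with rfl | hnpos
    · have hpX : p = X + C (p.coeff 0) := by
        have h1 : p.degree ≤ 1 := natDegree_le_iff_degree_le.mp hn.le
        have h2 := eq_X_add_C_of_degree_le_one h1
        have h3 := hp.coeff_natDegree
        rw [hn, zero_add] at h3
        rwa [h3, C_1, one_mul] at h2
      obtain ⟨a, ha⟩ := hp0.neg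
      refine ⟨[a], ?_, rfl, by simp [ha], fun _ => by simp⟩
      intro x hx
      rw [List.mem_singleton] at hx
      subst hx
      refine ⟨fun i => (v i).eval (-p.coeff 0), ?_⟩
      rw [← eval_polyForm, ha]
      obtain ⟨c, hc⟩ := hv
      have h1 := congrArg (eval (-p.coeff 0)) hc
      rw [eval_mul] at h1
      have h2 : p.eval (-p.coeff 0) = 0 := by
        conv_lhs => rw [hpX]
        simp
      rw [h2, zero_mul, eval_sub, eval_X, sub_eq_zero] at h1
      exact h1
    rcases subsingleton_or_nontrivial R with hR | hR
    · exact absurd hn (by rw [Subsingleton.elim p 0, natDegree_zero]; omega)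
    let _ (m : MaximalSpectrum R) : Field (R ⧸ m.asIdeal) := Ideal.Quotient.field m.asIdeal
    have hinf' (m : MaximalSpectrum R) : Infinite (R ⧸ m.asIdeal) := hinf _ m.isMaximal
    let φ (m : MaximalSpectrum R) : R →+* R ⧸ m.asIdeal := Ideal.Quotient.mk m.asIdeal
    have hpm (m) : (p.map (φ m)).Monic := hp.map _
    have hpd (m) : (p.map (φ m)).natDegree = n + 1 := by rw [hp.natDegree_map, hn]
    have hp0m (m) : (p.map (φ m)).coeff 0 ≠ 0 := by
      rw [coeff_map]; exact (hp0.map (φ m)).ne_zero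
    have hmap {a b : R[X]} (m) (h : a ∣ b) : a.map (φ m) ∣ b.map (φ m) :=
      map_dvd (mapRingHom (φ m)) h
    have hvm (m) : p.map (φ m) ∣ polyForm (B.map (φ m)) (fun i => (v i).map (φ m)) - X := by
      have := hmap m hv
      rwa [Polynomial.map_sub, map_X, map_polyForm] at this
    choose x₀ f₀ hx₀ hf₀ hfd₀ hs₀ using fun m =>
      exists_reflection_and_multiplier (hpm m) (by rw [hpd m]; omega) (hp0m m) (hvm m)
    choose x hx using fun i => exists_forall_map_eq_of_finite fun m => x₀ m i
    obtain ⟨f, hf, hff⟩ := exists_monic_forall_map_eq (d := n) f₀ hf₀ fun m => by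
      rw [hfd₀ m, hpd m, Nat.add_sub_cancel]
    have hfdeg : f.degree = n := by
      rw [← sub_add_cancel f (X ^ n), degree_add_eq_right_of_degree_lt (by rwa [degree_X_pow]),
        degree_X_pow]
    have hfn : f.natDegree = n := natDegree_eq_of_degree_eq_some hfdeg
    have hfm : f.Monic := by
      have := monic_X_pow_add hf
      rwa [add_sub_cancel] at this
    have hxm (m) : (fun i => (x i).map (φ m)) = x₀ m := funext fun i => hx i m
    have hcop : IsCoprime p (polyForm B x) := isCoprime_of_forall_map hp fun m => by
      have := (hx₀ m).symm
      rwa [← hxm m, ← map_polyForm] at this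
    obtain ⟨t, s, hts⟩ := hcop
    have hs : p ∣ s * polyForm B x - 1 := ⟨-t, by linear_combination hts⟩
    set v1 : ι → R[X] := v - (s * QuadraticMap.polar (polyForm B) x v) • x with hv1
    have hv1X : p ∣ polyForm B v1 - X := by
      rw [hv1, map_sub_smul_polar, add_sub_right_comm]
      exact dvd_add hv (hs.mul_left _)
    have hlocal (m) := hs₀ m (s.map (φ m)) (by
        have := hmap m hs
        rwa [Polynomial.map_sub, Polynomial.map_mul, map_polyForm, hxm, Polynomial.map_one] at this)
      (fun i => (v1 i).map (φ m)) (by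
        funext i
        rw [hv1, ← hxm m]
        simp only [Pi.sub_apply, Pi.smul_apply, smul_eq_mul, Polynomial.map_sub,
          Polynomial.map_mul, map_polar_polyForm])
    set v' : ι → R[X] := fun i => (f * v1 i) %ₘ p with hv'
    have hv'm (m) (i) : (f₀ m * (v1 i).map (φ m)) %ₘ p.map (φ m) = (v' i).map (φ m) := by
      rw [hv', map_modByMonic _ hp, Polynomial.map_mul, hff]
    have hcofm (m) : cofactor (B.map (φ m)) (p.map (φ m)) (f₀ m) (fun i => (v1 i).map (φ m)) =
        (cofactor B p f v1).map (φ m) := by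
      rw [cofactor, cofactor, map_divByMonic _ hp, Polynomial.map_sub, Polynomial.map_mul,
        Polynomial.map_pow, map_X, hff, map_polyForm]
      simp only [hv'm]
      rfl
    have hunit : IsUnit (gramForm B fun i => (v' i).coeff 0) :=
      isUnit_of_forall_mk_ne_zero fun m => by
        have := (hlocal m).1
        simp only [hv'm, coeff_map] at this
        rwa [← map_gramForm (φ m) B (fun i => (v' i).coeff 0)] at this
    have hfc : IsCoprime f (cofactor B p f v1) := isCoprime_of_forall_map hfm fun m => by
      have := (hlocal m).2
      rwa [hcofm, ← hff] at this
    have hmul := mul_cofactor hp f hv1X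
    rw [← hv'] at hmul
    set h := cofactor B p f v1 with hh
    have hv'deg : ∀ i, (v' i).natDegree ≤ n := by
      intro i
      have : (v' i).natDegree < p.natDegree := natDegree_modByMonic_lt (f * v1 i) hp (fun h1 => by
        rw [h1, natDegree_one] at hn; omega)
      omega
    have hprodm : (p * h).Monic := by
      rw [hmul]
      refine (monic_X.mul (hfm.pow 2)).sub_of_left ?_
      refine degree_lt_degree (lt_of_le_of_lt (natDegree_polyForm_le hv'deg) ?_)
      rw [monic_X.natDegree_mul (hfm.pow 2), hfm.natDegree_pow, natDegree_X, hfn]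
      omega
    have hprodd : (p * h).natDegree = 2 * n + 1 := by
      rw [hmul, natDegree_sub_eq_left_of_natDegree_lt] <;>
        rw [monic_X.natDegree_mul (hfm.pow 2), hfm.natDegree_pow, natDegree_X, hfn]
      · omega
      · exact lt_of_le_of_lt (natDegree_polyForm_le hv'deg) (by omega)
    have hhm : h.Monic := hp.of_mul_monic_left hprodm
    have hhd : h.natDegree = n := by
      rw [hp.natDegree_mul hhm, hn] at hprodd
      omega
    have hconst : p.coeff 0 * h.coeff 0 = -gramForm B (fun i => (v' i).coeff 0) := by
      have h1 := congrArg (eval 0) hmul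
      rw [eval_mul, eval_sub, eval_mul, eval_X, zero_mul, zero_sub, eval_polyForm] at h1
      simpa only [← coeff_zero_eq_eval_zero] using h1
    have hh0 : IsUnit (h.coeff 0) := by
      have := hunit.neg
      rw [← hconst] at this
      exact isUnit_of_mul_isUnit_right this
    obtain ⟨g, g', hg⟩ := hfc
    obtain ⟨l, hl, hlen, hprod, -⟩ := ih h (g • v') hhm hhd hh0 (by
      rw [QuadraticMap.map_smul, smul_eq_mul]
      refine ⟨-(g * g * p) - X * g' * (g * f + 1), ?_⟩
      linear_combination (g * g) * hmul + X * (g * f + 1) * hg)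
    obtain ⟨a, ha⟩ := hunit
    refine ⟨a :: l.map (fun x => x⁻¹), ?_, ?_, ?_, fun _ => by simp⟩
    · intro y hy
      rcases List.mem_cons.mp hy with rfl | hy
      · exact ⟨_, ha.symm⟩
      · obtain ⟨z, hz, rfl⟩ := List.mem_map.mp hy
        exact (hl z hz).inv
    · rw [List.length_cons, List.length_map]
      exact hlen.add_right 1
    · rw [List.prod_cons, ← List.prod_inv, Units.val_mul, ha]
      have h1 : gramForm B (fun i => (v' i).coeff 0) =
          (-1) ^ (n + 1) * p.coeff 0 * (l.prod : R) := by
        rw [hprod]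
        have h2 : ((-1 : R) ^ n) * (-1) ^ n = 1 := by rw [← mul_pow]; simp
        linear_combination hconst + p.coeff 0 * h.coeff 0 * h2
      rw [h1, mul_assoc, Units.mul_inv, mul_one]

end Semilocal

section Generator

theorem exists_injective_algHom (R S K : Type*) [CommRing R] [CommRing S] [Algebra R S]
    [Module.Finite R S] [Module.Free R S] [Algebra.Etale R S] [Field K] [IsSepClosed K]
    [Algebra R K] :
    ∃ σ : Fin (Module.finrank R S) → (S →ₐ[R] K), Function.Injective σ := by
  have : Nontrivial R := (algebraMap R K).domain_nontrivial
  obtain ⟨N, ⟨e⟩⟩ := Algebra.IsFiniteSplit.nonempty_algEquiv_fun K (K ⊗[R] S)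
  have hN : Module.finrank R S = N := by
    rw [← Module.finrank_baseChange (R := K), e.toLinearEquiv.finrank_eq, Module.finrank_fin_fun]
  subst hN
  let τ (i : Fin (Module.finrank R S)) : K ⊗[R] S →ₐ[K] K :=
    (Pi.evalAlgHom K (fun _ => K) i).comp e.toAlgHom
  refine ⟨fun i => ((τ i).restrictScalars R).comp Algebra.TensorProduct.includeRight,
    fun i j hij => ?_⟩
  have h1 : τ i = τ j := Algebra.TensorProduct.ext (by ext) hij
  by_contra hne
  have h2 := congrArg (fun ψ => ψ (e.symm (Pi.single i 1))) h1
  simp [τ, Pi.single_eq_of_ne (Ne.symm hne)] at h2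

variable {k K : Type*} [Field k] [Infinite k] [Field K] [Algebra k K]

theorem exists_separating_combination {R S : Type*} [CommRing R] [CommRing S] [Algebra R S]
    [Algebra R K] {ι ι' : Type*} [Fintype ι] [Fintype ι']
    (b : Module.Basis ι' R S) (σ : ι → (S →ₐ[R] K)) (hσ : Function.Injective σ) :
    ∃ x : ι' → k, Function.Injective fun i => ∑ l, algebraMap k K (x l) * σ i (b l) := by
  classical
  let L (i : ι) : (ι' → k) →ₗ[k] K := Fintype.linearCombination k (fun l => σ i (b l))
  have hL (i : ι) (x : ι' → k) : L i x = ∑ l, algebraMap k K (x l) * σ i (b l) := by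
    simp [L, Fintype.linearCombination_apply, Algebra.smul_def]
  let s : Finset (Subspace k (ι' → k)) :=
    (Finset.univ.filter fun q : ι × ι => q.1 ≠ q.2).image fun q => LinearMap.ker (L q.1 - L q.2)
  have hs : ⊤ ∉ s := by
    intro h
    obtain ⟨q, hq, hker⟩ := Finset.mem_image.mp h
    refine (Finset.mem_filter.mp hq).2 (hσ ?_)
    have h0 := LinearMap.ker_eq_top.mp hker
    apply AlgHom.toLinearMap_injective
    refine b.ext fun l => ?_
    have h1 := congrArg (fun ψ => ψ (Pi.single l 1)) h0
    simpa [L, sub_eq_zero] using h1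
  have hne := Subspace.biUnion_ne_univ_of_top_notMem hs
  obtain ⟨x, hx⟩ := (Set.ne_univ_iff_exists_notMem _).mp hne
  refine ⟨x, fun i j hij => ?_⟩
  by_contra hne
  apply hx
  simp only [Set.mem_iUnion]
  refine ⟨_, Finset.mem_image_of_mem _ (Finset.mem_filter.mpr ⟨Finset.mem_univ (i, j), hne⟩), ?_⟩
  simp only [SetLike.mem_coe, LinearMap.mem_ker, LinearMap.sub_apply, hL, sub_eq_zero]
  exact hij

theorem exists_shift {ι : Type*} [Finite ι] (a γ : ι → K) (ha : ∀ i, a i ≠ 0)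
    (hγ : Function.Injective γ) (P : k[X]) (hP : P.Monic) :
    ∃ c : k, P.eval (-c) ≠ 0 ∧
      Function.Injective fun i => a i * (γ i + algebraMap k K c) ^ 2 := by
  have hroots : ∀ Q : K[X], Q ≠ 0 → {c : k | Q.eval (algebraMap k K c) = 0}.Finite := by
    intro Q hQ
    have : {z : K | Q.IsRoot z}.Finite := by
      by_contra hinf
      exact hQ (eq_zero_of_infinite_isRoot Q hinf)
    exact this.preimage (algebraMap k K).injective.injOn
  have hfin : ({c : k | (P.map (algebraMap k K)).eval (-(algebraMap k K c)) = 0} ∪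
      ⋃ q ∈ {q : ι × ι | q.1 ≠ q.2}, {c : k | a q.1 * (γ q.1 + algebraMap k K c) ^ 2 =
        a q.2 * (γ q.2 + algebraMap k K c) ^ 2}).Finite := by
    refine Set.Finite.union ?_ (Set.Finite.biUnion (Set.toFinite _) fun q hq => ?_)
    · refine (hroots ((P.map (algebraMap k K)).comp (-X)) ?_).subset fun c hc => ?_
      · intro h0
        have h1 := congrArg (fun r => r.comp (-X)) h0
        simp only [comp_assoc, zero_comp] at h1
        simp at h1
        exact hP.ne_zero h1
      · simpa using hc
    · refine (hroots (C (a q.1) * (C (γ q.1) + X) ^ 2 - C (a q.2) * (C (γ q.2) + X) ^ 2) ?_).subset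
        fun c hc => ?_
      · intro h0
        have h1 := congrArg (eval (-(γ q.2))) h0
        simp only [eval_sub, eval_mul, eval_C, eval_pow, eval_add, eval_X, add_neg_cancel,
          eval_zero, ne_eq, OfNat.ofNat_ne_zero, not_false_eq_true, zero_pow, mul_zero, sub_zero,
          mul_eq_zero, ha, false_or, pow_eq_zero_iff] at h1
        exact hq (hγ (by linear_combination h1))
      · simpa [sub_eq_zero] using hc
  obtain ⟨c, hc⟩ := hfin.exists_notMem
  simp only [Set.mem_union, Set.mem_ofPred_eq, Set.mem_iUnion, not_or, not_exists] at hc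
  refine ⟨c, fun h0 => hc.1 ?_, fun i j hij => ?_⟩
  · rw [← map_neg, eval_map_algebraMap, aeval_algebraMap_apply, ← map_zero (algebraMap k K)]
    simp [h0]
  · by_contra hne
    exact hc.2 (i, j) hne hij

end Generator

section PowerBasis

variable {R S : Type*} [CommRing R] [CommRing S] [Algebra R S]

theorem algebraMap_det_ne_zero {K : Type*} [Field K] [Algebra R K] {n : ℕ}
    (b : Module.Basis (Fin n) R S) (σ : Fin n → (S →ₐ[R] K)) (θ : S)
    (h : Function.Injective fun i => σ i θ) :
    algebraMap R K (b.det fun i : Fin n => θ ^ (i : ℕ)) ≠ 0 := by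
  have hV : Matrix.vandermonde (fun i => σ i θ) =
      (Matrix.of fun i l => σ i (b l)) *
        (b.toMatrix fun i : Fin n => θ ^ (i : ℕ)).map (algebraMap R K) := by
    ext i j
    rw [Matrix.vandermonde_apply, Matrix.mul_apply, ← map_pow]
    conv_lhs => rw [← b.sum_repr (θ ^ (j : ℕ))]
    simp [Module.Basis.toMatrix_apply, Algebra.smul_def, mul_comm]
  have hdet := congrArg Matrix.det hV
  rw [Matrix.det_mul] at hdet
  rw [Module.Basis.det_apply, RingHom.map_det]
  intro h0
  rw [RingHom.mapMatrix_apply] at h0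
  rw [h0, mul_zero] at hdet
  exact Matrix.det_vandermonde_ne_zero_iff.mpr h hdet

theorem exists_powerBasis_of_isUnit_det {n : ℕ} (b : Module.Basis (Fin n) R S) (θ : S)
    (h : IsUnit (b.det fun i : Fin n => θ ^ (i : ℕ))) : ∃ pb : PowerBasis R S, pb.gen = θ ∧ pb.dim = n := by
  obtain ⟨h1, h2⟩ := (Module.Basis.is_basis_iff_det b).mpr h
  exact ⟨⟨θ, n, Module.Basis.mk h1 h2.ge, fun i => by rw [Module.Basis.mk_apply]⟩, rfl, rfl⟩

theorem isUnit_add_algebraMap {P : R[X]} {γ : S} (hP : aeval γ P = 0) {c : R}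
    (hc : IsUnit (P.eval (-c))) : IsUnit (γ + algebraMap R S c) := by
  have h1 := map_dvd (aeval γ) (X_sub_C_dvd_sub_C_eval (a := -c) (p := P))
  rw [C_neg, sub_neg_eq_add, map_add, map_sub, aeval_X, aeval_C, aeval_C, hP, zero_sub] at h1
  exact isUnit_of_dvd_unit h1 (hc.map (algebraMap R S)).neg

/-- Over a semilocal domain with infinite residue fields, every unit of a finite étale algebra
becomes a generator of the algebra after multiplication by the square of a unit. -/
theorem exists_powerBasis_mul_sq [IsDomain R] [IsNoetherianRing R] [Finite (MaximalSpectrum R)]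
    (hinf : ∀ m : Ideal R, m.IsMaximal → Infinite (R ⧸ m)) [Module.Finite R S]
    [Algebra.Etale R S] (a : Sˣ) :
    ∃ (u : Sˣ) (pb : PowerBasis R S), pb.gen = a * u ^ 2 := by
  let _ (m : MaximalSpectrum R) : Field (R ⧸ m.asIdeal) := Ideal.Quotient.field m.asIdeal
  have hinf' (m : MaximalSpectrum R) : Infinite (R ⧸ m.asIdeal) := hinf _ m.isMaximal
  have : Module.Free R S := by
    refine Module.free_of_flat_of_finrank_eq R S (Module.finrank R S) fun m => ?_
    rw [← Ideal.finrank_fiber_eq_finrank (M := S) m.asIdeal,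
      ← Module.finrank_baseChange (R := m.asIdeal.ResidueField)]
    exact (TensorProduct.AlgebraTensorModule.cancelBaseChange R (R ⧸ m.asIdeal)
      m.asIdeal.ResidueField m.asIdeal.ResidueField S).finrank_eq
  let b := Module.finBasis R S
  choose σ hσ using fun m : MaximalSpectrum R =>
    exists_injective_algHom R S (AlgebraicClosure (R ⧸ m.asIdeal))
  choose x₀ hx₀ using fun m : MaximalSpectrum R =>
    exists_separating_combination (k := R ⧸ m.asIdeal) b (σ m) (hσ m)
  choose x hx using fun l => exists_forall_mk_eq fun m => x₀ m l
  let γ : S := ∑ l, x l • b l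
  have halg (m : MaximalSpectrum R) (r : R) :
      algebraMap R (AlgebraicClosure (R ⧸ m.asIdeal)) r =
      algebraMap (R ⧸ m.asIdeal) _ (Ideal.Quotient.mk m.asIdeal r) :=
    IsScalarTower.algebraMap_apply R (R ⧸ m.asIdeal) _ r
  have hγ (m : MaximalSpectrum R) : Function.Injective fun i => σ m i γ := by
    have : (fun i => σ m i γ) =
        fun i => ∑ l, algebraMap (R ⧸ m.asIdeal) _ (x₀ m l) * σ m i (b l) := by
      funext i
      simp only [γ, map_sum, Algebra.smul_def, map_mul, AlgHom.commutes, halg, hx]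
    rw [this]
    exact hx₀ m
  obtain ⟨P, hP, hPγ⟩ := Algebra.IsIntegral.isIntegral (R := R) γ
  choose c₀ hc₀ hc₀' using fun m : MaximalSpectrum R =>
    exists_shift (k := R ⧸ m.asIdeal) (fun i => σ m i a) (fun i => σ m i γ)
      (fun i => (a.isUnit.map (σ m i)).ne_zero) (hγ m) (P.map (Ideal.Quotient.mk m.asIdeal))
      (hP.map _)
  obtain ⟨c, hc⟩ := exists_forall_mk_eq c₀
  have hu : IsUnit (γ + algebraMap R S c) := by
    refine isUnit_add_algebraMap (P := P) hPγ (isUnit_of_forall_mk_ne_zero fun m => ?_)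
    have := hc₀ m
    rwa [← hc, ← map_neg, eval_map_apply] at this
  obtain ⟨u, hu⟩ := hu
  obtain ⟨pb, hpb, -⟩ := exists_powerBasis_of_isUnit_det b (a * u ^ 2 : S)
    (isUnit_of_forall_mk_ne_zero fun m => by
      have h1 := algebraMap_det_ne_zero b (σ m) (a * u ^ 2 : S) (by
        have := hc₀' m
        simp only [← hc, ← halg] at this
        simpa only [map_mul, map_pow, hu, map_add, AlgHom.commutes] using this)
      rw [halg] at h1
      exact fun h0 => h1 (by rw [h0, map_zero]))
  exact ⟨u, pb, hpb⟩

end PowerBasis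

section NormPrinciple

variable {R S V : Type*} [CommRing R] [CommRing S] [Algebra R S] [AddCommGroup V] [Module R V]

theorem parityProducts_mul {A M : Type*} [CommRing A] [AddCommGroup M] [Module A M]
    {Q : QuadraticForm A M} {i j : ℕ} {a b : Aˣ} (ha : a ∈ parityProducts Q i)
    (hb : b ∈ parityProducts Q j) : a * b ∈ parityProducts Q (i + j) := by
  obtain ⟨l, hl, hn, rfl⟩ := ha
  obtain ⟨l', hl', hn', rfl⟩ := hb
  refine ⟨l ++ l', fun x hx => ?_, ?_, List.prod_append⟩
  · rcases List.mem_append.mp hx with h | h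
    exacts [hl x h, hl' x h]
  · rw [List.length_append]
    exact hn.add hn'

theorem Represents.sq_mul {A M : Type*} [CommRing A] [AddCommGroup M] [Module A M]
    {Q : QuadraticForm A M} {a : Aˣ} (ha : Represents Q a) (r : Aˣ) :
    Represents Q (r ^ 2 * a) := by
  obtain ⟨v, hv⟩ := ha
  refine ⟨(r : A) • v, ?_⟩
  rw [QuadraticMap.map_smul, hv]
  simp [sq]

variable [Invertible (2 : R)]

/-- The Gram matrix of a family of vectors. -/
noncomputable def gramMatrix {ι : Type*} (q : QuadraticForm R V) (w : ι → V) : Matrix ι ι R :=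
  Matrix.of fun i j => QuadraticMap.associated (R := R) q (w i) (w j)

theorem gramForm_gramMatrix {ι : Type*} [Fintype ι] (q : QuadraticForm R V) (w : ι → V)
    (x : ι → R) : gramForm (gramMatrix q w) x = q (∑ i, x i • w i) := by
  rw [← QuadraticMap.associated_eq_self_apply R q, gramForm_apply]
  simp only [gramMatrix, Matrix.of_apply, map_sum, LinearMap.sum_apply, map_smul,
    LinearMap.smul_apply, smul_eq_mul]
  rw [Finset.sum_comm]
  refine Finset.sum_congr rfl fun i _ => ?_
  rw [Finset.mul_sum]
  refine Finset.sum_congr rfl fun j _ => ?_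
  ring

theorem baseChange_sum_tmul {ι : Type*} [Fintype ι] (q : QuadraticForm R V) (s : ι → S)
    (w : ι → V) : q.baseChange S (∑ i, s i ⊗ₜ[R] w i) =
      gramForm ((gramMatrix q w).map (algebraMap R S)) s := by
  let _ : Invertible (2 : S) :=
    (Invertible.map (algebraMap R S) (2 : R)).copy _ (map_ofNat (algebraMap R S) 2).symm
  rw [← QuadraticMap.associated_eq_self_apply S (q.baseChange S),
    QuadraticForm.associated_baseChange, gramForm_apply]
  simp only [gramMatrix, Matrix.map_apply, Matrix.of_apply, map_sum, LinearMap.sum_apply,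
    LinearMap.BilinForm.baseChange_tmul]
  rw [Finset.sum_comm]
  refine Finset.sum_congr rfl fun i _ => Finset.sum_congr rfl fun j _ => ?_
  rw [Algebra.smul_def]
  ring

variable [IsDomain R] [Finite (MaximalSpectrum R)]

theorem exists_list_prod_eq_unitNorm (hinf : ∀ m : Ideal R, m.IsMaximal → Infinite (R ⧸ m))
    (q : QuadraticForm R V) (pb : PowerBasis R S) (a : Sˣ) (ha : pb.gen = a)
    (hrep : Represents (q.baseChange S) a) :
    ∃ l : List Rˣ, (∀ x ∈ l, Represents q x) ∧ l.length ≡ Module.finrank R S [MOD 2] ∧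
      l.prod = unitNorm R S a ∧ (Module.finrank R S ≠ 0 → l ≠ []) := by
  obtain ⟨z, hz⟩ := hrep
  obtain ⟨N, s, w, rfl⟩ := TensorProduct.exists_sum_tmul_eq z
  rw [baseChange_sum_tmul] at hz
  choose v hv using fun i => pb.exists_eq_aeval' (s i)
  set p := minpoly R pb.gen with hp
  have hpm : p.Monic := minpoly.monic pb.isIntegral_gen
  have hpd : p.natDegree = Module.finrank R S := by rw [pb.finrank, hp, pb.natDegree_minpoly]
  have hnorm : Algebra.norm R (a : S) = (-1) ^ Module.finrank R S * p.coeff 0 := by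
    rw [← ha, Algebra.PowerBasis.norm_gen_eq_coeff_zero_minpoly, pb.finrank]
  have hp0 : IsUnit (p.coeff 0) := by
    have h1 : IsUnit (Algebra.norm R (a : S)) := a.isUnit.map (Algebra.norm R)
    rw [hnorm] at h1
    exact isUnit_of_mul_isUnit_right h1
  have hdvd : p ∣ polyForm (gramMatrix q w) v - X := by
    rw [← modByMonic_eq_zero_iff_dvd hpm]
    by_contra hne
    have h1 : aeval pb.gen ((polyForm (gramMatrix q w) v - X) %ₘ p) = 0 := by
      rw [aeval_modByMonic_eq_self_of_root (minpoly.aeval R pb.gen), map_sub, aeval_X,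
        sub_eq_zero]
      have h2 := map_gramForm (aeval pb.gen : R[X] →ₐ[R] S).toRingHom ((gramMatrix q w).map C) v
      have h3 : ((gramMatrix q w).map C).map (aeval pb.gen : R[X] →ₐ[R] S).toRingHom =
          (gramMatrix q w).map (algebraMap R S) := by ext; simp
      rw [h3] at h2
      have h4 : s = fun i => (aeval pb.gen : R[X] →ₐ[R] S).toRingHom (v i) := funext hv
      refine h2.trans ?_
      rw [← h4, hz, ha]
    have h2 := pb.dim_le_natDegree_of_root hne h1
    rw [← pb.natDegree_minpoly, ← hp] at h2
    have h3 := natDegree_lt_natDegree hne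
      (degree_modByMonic_lt (polyForm (gramMatrix q w) v - X) hpm)
    omega
  obtain ⟨l, hl, hlen, hprod, hne⟩ :=
    exists_list_prod_eq hinf (gramMatrix q w) _ p v hpm hpd hp0 hdvd
  refine ⟨l, fun x hx => ?_, hlen, Units.ext ?_, hne⟩
  · obtain ⟨y, hy⟩ := hl x hx
    exact ⟨_, (gramForm_gramMatrix q w y).symm.trans hy⟩
  · rw [hprod, ← hnorm]
    rfl

variable [IsNoetherianRing R] [Module.Finite R S] [Algebra.Etale R S]

/-- Knebusch's norm principle: the norm of a unit represented by `q` over a finite étale algebra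
of degree `n` is a product of units represented by `q`, with a number of factors congruent to `n`
modulo `2`. Neither projectivity of the module nor unimodularity of the form is needed. -/
theorem unitNorm_mem_parityProducts (hinf : ∀ m : Ideal R, m.IsMaximal → Infinite (R ⧸ m))
    (q : QuadraticForm R V) (a : Sˣ) (ha : Represents (q.baseChange S) a) :
    unitNorm R S a ∈ parityProducts q (Module.finrank R S) := by
  obtain ⟨u, pb, hpb⟩ := exists_powerBasis_mul_sq hinf a
  obtain ⟨l, hl, hlen, hprod, hne⟩ := exists_list_prod_eq_unitNorm hinf q pb (u ^ 2 * a)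
    (by rw [hpb, Units.val_mul, Units.val_pow_eq_pow_val, mul_comm]) (ha.sq_mul u)
  have ha' : unitNorm R S a = ((unitNorm R S u)⁻¹) ^ 2 * l.prod := by
    rw [hprod, map_mul, map_pow, ← mul_assoc, ← mul_pow, inv_mul_cancel, one_pow, one_mul]
  rw [ha']
  rcases l with _ | ⟨b, l⟩
  · have h0 : Module.finrank R S = 0 := by
      by_contra h
      exact hne h rfl
    have : Subsingleton S := by
      have h1 := pb.finrank
      rw [h0] at h1
      have : IsEmpty (Fin pb.dim) := by rw [← h1]; infer_instance
      exact pb.basis.repr.toEquiv.subsingleton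
    have hu : u = 1 := Subsingleton.elim _ _
    rw [hu, map_one, inv_one, one_pow, one_mul]
    exact ⟨[], hl, hlen, rfl⟩
  · refine ⟨((unitNorm R S u)⁻¹ ^ 2 * b) :: l, fun x hx => ?_, hlen, ?_⟩
    · rcases List.mem_cons.mp hx with rfl | hx
      · exact (hl b List.mem_cons_self).sq_mul _
      · exact hl x (List.mem_cons_of_mem _ hx)
    · rw [List.prod_cons, List.prod_cons, mul_assoc]

theorem unitNorm_mem_evenProducts (hinf : ∀ m : Ideal R, m.IsMaximal → Infinite (R ⧸ m))
    (q : QuadraticForm R V) (a : Sˣ) (ha : a ∈ evenProducts (q.baseChange S)) :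
    unitNorm R S a ∈ evenProducts q := by
  obtain ⟨l, hl, hlen, rfl⟩ := ha
  have key : ∀ l : List Sˣ, (∀ x ∈ l, Represents (q.baseChange S) x) →
      unitNorm R S l.prod ∈ parityProducts q (l.length * Module.finrank R S) := by
    intro l
    induction l with
    | nil => exact fun _ => ⟨[], by simp, by simp [Nat.ModEq], by simp⟩
    | cons x l ih =>
      intro h
      rw [List.prod_cons, map_mul, List.length_cons, add_mul, one_mul, add_comm]
      exact parityProducts_mul (unitNorm_mem_parityProducts hinf q x (h x List.mem_cons_self))
        (ih fun y hy => h y (List.mem_cons_of_mem _ hy))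
  obtain ⟨l', h1, h2, h3⟩ := key l hl
  refine ⟨l', h1, h2.trans ?_, h3⟩
  simpa using hlen.mul_right (Module.finrank R S)

end NormPrinciple

end NormPrinciple

theorem mainTheorem2 {R S V : Type*} [CommRing R] [IsDomain R] [IsNoetherianRing R]
    [Finite (MaximalSpectrum R)]
    (hinf : ∀ m : Ideal R, m.IsMaximal → Infinite (R ⧸ m))
    (hchar : ∀ m : Ideal R, m.IsMaximal → ringChar (R ⧸ m) ≠ 2)
    [CommRing S] [Algebra R S] [Module.Finite R S] [Algebra.Etale R S]
    [AddCommGroup V] [Module R V] (q : QuadraticForm R V)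
    (hq : NormPrinciple.IsQuadraticSpace q) :
    letI : Invertible (2 : R) := NormPrinciple.invertibleTwo hchar
    (NormPrinciple.evenProducts (q.baseChange S)).map (NormPrinciple.unitNorm R S) ≤
        NormPrinciple.evenProducts q ∧
      ∀ a : Sˣ, NormPrinciple.Represents (q.baseChange S) a →
        NormPrinciple.unitNorm R S a ∈
          NormPrinciple.parityProducts q (Module.finrank R S) := by
  let _ : Invertible (2 : R) := NormPrinciple.invertibleTwo hchar
  refine ⟨?_, fun a ha => NormPrinciple.unitNorm_mem_parityProducts hinf q a ha⟩
  rintro _ ⟨a, ha, rfl⟩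
  exact NormPrinciple.unitNorm_mem_evenProducts hinf q a ha
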